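/- Let $\mathcal H$ be a complex Hilbert space and let $J$ be a bounded linear operator on $\mathcal H$ with $J=J^*=J^{-1}$. Let $L(\mathcal H)$ be the algebra of bounded linear operators on $\mathcal H$, regarded as a real Banach space with the operator norm. For $T\in L(\mathcal H)$ let $T^{\#}=JT^*J$ be its $J$-adjoint, and put $$\mathcal Q=\{Q\in L(\mathcal H): Q^2=Q,\ QQ^{\#}=Q^{\#}Q\},\qquad \mathcal E=\{E\in L(\mathcal H): E^2=E,\ E^{\#}=E\},$$ the sets of $J$-normal and of $J$-selfadjoint projections. A subset $S$ of a real Banach space $X$ is a real-analytic submanifold of $X$ if every $x\in S$ has an open neighbourhood $U$ in $X$ with a real-analytic diffeomorphism $\varphi$ of $U$ onto an open subset of $X$ (with real-analytic inverse) and a closed complemented real subspace $W\subseteq X$ (which may depend on $x$) such that $\varphi(U\cap S)=\varphi(U)\cap W$. A continuous map between two such submanifolds is a real-analytic submersion if, with respect to these charts, its local expressions are real-analytic and their differentials are surjective (onto the model subspace of the target) with complemented kernels. Then: (i) $\mathcal Q$ is a real-analytic submanifold of $L(\mathcal H)$. (ii) $\mathcal E$ is a real-analytic submanifold of $L(\mathcal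 H)$. (iii) The map $F(Q)=QQ^{\#}$ is a real-analytic submersion from $\mathcal Q$ onto $\mathcal E$ (in particular $F(\mathcal Q)=\mathcal E$). -/

import Mathlib

/-- `φ` is a real-analytic chart of the real Banach space `X` (an analytic homeomorphism between
open subsets of `X` with analytic inverse) which flattens the subset `S` onto an open subset of the
closed complemented real subspace `W`. -/
structure IsAnalyticSubmanifoldChart {X : Type*} [NormedAddCommGroup X] [NormedSpace ℝ X]
    (S : Set X) (φ : OpenPartialHomeomorph X X) (W : Submodule ℝ X) : Prop where
  analytic : AnalyticOnNhd ℝ φ φ.source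
  analytic_symm : AnalyticOnNhd ℝ φ.symm φ.target
  complemented : W.ClosedComplemented
  image_eq : φ '' (φ.source ∩ S) = φ.target ∩ (W : Set X)

/-- `S` is a (split) real-analytic submanifold of the real Banach space `X`: around each of its
points there is a chart of `X` flattening `S` onto a closed complemented subspace. The model
subspace may vary with the point. -/
def IsAnalyticSubmanifold {X : Type*} [NormedAddCommGroup X] [NormedSpace ℝ X]
    (S : Set X) : Prop :=
  ∀ x ∈ S, ∃ (φ : OpenPartialHomeomorph X X) (W : Submodule ℝ X),
    x ∈ φ.source ∧ IsAnalyticSubmanifoldChart S φ W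

/-- The restriction of `F` to `S` is a real-analytic submersion from the submanifold `S` to the
submanifold `T`: it is continuous, and in all submanifold charts `φ` of `S` around `x` (with model
`W`) and `ψ` of `T` around `F x` (with model `V`), the local expression `w ↦ ψ (F (φ⁻¹ w))` on `W`
is analytic at `φ x`, and its differential there maps `W` onto `V` and has complemented kernel.
(By continuity, the local expression takes values in `V` near `φ x`; only the values of `F` on `S`
matter.) -/
structure IsAnalyticSubmersion {X Y : Type*} [NormedAddCommGroup X] [NormedSpace ℝ X]
    [NormedAddCommGroup Y] [NormedSpace ℝ Y] (F : X → Y) (S : Set X) (T : Set Y) : Prop where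
  source_submanifold : IsAnalyticSubmanifold S
  target_submanifold : IsAnalyticSubmanifold T
  mapsTo : Set.MapsTo F S T
  continuousOn : ContinuousOn F S
  submersive : ∀ x ∈ S, ∀ (φ : OpenPartialHomeomorph X X) (W : Submodule ℝ X)
    (ψ : OpenPartialHomeomorph Y Y) (V : Submodule ℝ Y) (w₀ : W),
    IsAnalyticSubmanifoldChart S φ W → x ∈ φ.source → (w₀ : X) = φ x →
    IsAnalyticSubmanifoldChart T ψ V → F x ∈ ψ.source →
      AnalyticAt ℝ (fun w : W => ψ (F (φ.symm (w : X)))) w₀ ∧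
      ∃ D : W →L[ℝ] Y, HasFDerivAt (fun w : W => ψ (F (φ.symm (w : X)))) D w₀ ∧
        D.range = V ∧ D.ker.ClosedComplemented

section Krein

variable {H : Type*} [NormedAddCommGroup H] [InnerProductSpace ℂ H] [CompleteSpace H]

/-- The `J`-adjoint `T^# = J T^* J`. -/
noncomputable def jAdjoint (J T : H →L[ℂ] H) : H →L[ℂ] H :=
  J * ContinuousLinearMap.adjoint T * J

/-- The set of `J`-normal projections. -/
def jNormalProjections (J : H →L[ℂ] H) : Set (H →L[ℂ] H) :=
  {Q | Q * Q = Q ∧ Q * jAdjoint J Q = jAdjoint J Q * Q}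

/-- The set of `J`-selfadjoint projections. -/
def jSelfadjointProjections (J : H →L[ℂ] H) : Set (H →L[ℂ] H) :=
  {E | E * E = E ∧ jAdjoint J E = E}

end Krein

/-!
Only two features of `L(H)` matter: it is a real Banach algebra `A`, and `T ↦ T^#` is a continuous
linear involution `τ` reversing products. The argument takes place at that generality.

*Submanifolds.* A set that is locally the fixed-point set of an analytic retraction is a
submanifold (`isAnalyticSubmanifold_of_local_retraction`). To retract a neighbourhood of a normal
idempotent `q` onto the normal idempotents, one writes down a polynomial `s y` in `y` and `τ y` with
`s q = 1` that intertwines the joint spectral idempotents of `(q, τ q)` with those of `(y, τ y)`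
whenever `y` is a normal idempotent. Its unitary part `u y = s y (τ(s y) s y)^{-1/2}`
(`exists_analytic_unitary_part`) satisfies `τ(u y) u y = 1` for all `y` near `q` and still
intertwines, so `y ↦ u y * q * τ (u y)` is a retraction. Selfadjoint idempotents are treated in the
same way. The inverse square root comes from the analytic inverse function theorem for `a ↦ a * a`
at `1`; uniqueness of local inverses gives its compatibility with `τ` and with commutants.

*Submersion.* An analytic map of submanifolds that has an analytic local section through each point
of the source is a submersion, whatever charts are used
(`isAnalyticSubmersion_of_local_section`). As `q ↦ q * τ q` is equivariant under conjugation by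
elements with `τ(u) u = 1`, the section through `q` is `y ↦ u y * q * τ (u y)`, where `u y` carries
`q * τ q` to `y`. The map is onto because it fixes every selfadjoint idempotent.
-/

open Filter Topology

/-! ### Retractions, sections and submanifolds -/

section Submanifolds

variable {X Y : Type*} [NormedAddCommGroup X] [NormedSpace ℝ X]
  [NormedAddCommGroup Y] [NormedSpace ℝ Y]

/-- The analytic inverse function theorem, with source and target shrunk so that both directions
are analytic everywhere. -/
lemma exists_analytic_openPartialHomeomorph [CompleteSpace X] [CompleteSpace Y] {f : X → Y} {x : X}
    (hf : AnalyticAt ℝ f x) (e : X ≃L[ℝ] Y) (h : HasFDerivAt f (e : X →L[ℝ] Y) x) :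
    ∃ φ : OpenPartialHomeomorph X Y, ⇑φ = f ∧ x ∈ φ.source ∧
      AnalyticOnNhd ℝ φ φ.source ∧ AnalyticOnNhd ℝ φ.symm φ.target := by
  have hs : HasStrictFDerivAt f (e : X →L[ℝ] Y) x := h.fderiv ▸ hf.hasStrictFDerivAt
  set φ₀ := hs.toOpenPartialHomeomorph f with hφ₀
  have hcoe : (φ₀ : X → Y) = f := hs.toOpenPartialHomeomorph_coe
  have hx : x ∈ φ₀.source := hs.mem_toOpenPartialHomeomorph_source
  have hsymm : AnalyticAt ℝ φ₀.symm (f x) := by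
    have := φ₀.analyticAt_symm' (𝕜 := ℝ) (i := e) hx (by rwa [hcoe]) (by rw [hcoe, h.fderiv])
    rwa [hcoe] at this
  have hV : IsOpen (φ₀.source ∩ φ₀ ⁻¹' {y | AnalyticAt ℝ φ₀.symm y}) :=
    φ₀.isOpen_inter_preimage (isOpen_analyticAt ℝ _)
  refine ⟨φ₀.restrOpen _ (hV.inter (isOpen_analyticAt ℝ f)), hcoe, ?_, ?_, ?_⟩
  · exact ⟨hx, ⟨hx, by simpa [hcoe] using hsymm⟩, hf⟩
  · intro y hy
    have : AnalyticAt ℝ f y := hy.2.2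
    rw [← hcoe] at this
    exact this
  · intro y hy
    have h1 : y ∈ φ₀.target := hy.1
    have h2 : AnalyticAt ℝ φ₀.symm (φ₀ (φ₀.symm y)) := hy.2.1.2
    rw [φ₀.right_inv h1] at h2
    exact h2

/-- A set which is locally the fixed-point set of an analytic retraction `r` is a submanifold,
modelled at `x` on the range of `p = Dr(x)`. The flattening map is
`y ↦ p (r y - x) + (1 - p) (y - r y)`, whose derivative at `x` is the identity because `p` is
idempotent. -/
theorem isAnalyticSubmanifold_of_local_retraction [CompleteSpace X] {S : Set X}
    (h : ∀ x ∈ S, ∃ r : X → X, AnalyticAt ℝ r x ∧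
      (∀ᶠ y in 𝓝 x, r y ∈ S) ∧ (∀ᶠ y in 𝓝 x, y ∈ S → r y = y)) :
    IsAnalyticSubmanifold S := by
  intro x hxS
  obtain ⟨r, hr, hrS, hfix⟩ := h x hxS
  have hrx : r x = x := hfix.self_of_nhds hxS
  set p : X →L[ℝ] X := fderiv ℝ r x with hp
  have hDr : HasFDerivAt r p x := hr.differentiableAt.hasFDerivAt
  have hrc : Tendsto r (𝓝 x) (𝓝 x) := by simpa [ContinuousAt, hrx] using hr.continuousAt
  have hpp : p.comp p = p := by
    have h1 : HasFDerivAt (r ∘ r) (p.comp p) x := HasFDerivAt.comp x (by rwa [hrx]) hDr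
    have h2 : r ∘ r =ᶠ[𝓝 x] r := by
      filter_upwards [hrS, hrc.eventually hfix] with y hy hy'
      exact hy' hy
    exact (h1.congr_of_eventuallyEq h2.symm).unique hDr
  have hppa (y : X) : p (p y) = p y := DFunLike.congr_fun hpp y
  let f : X → X := fun y => p (r y - x) + (y - r y - p (y - r y))
  have hf : AnalyticAt ℝ f x := by
    have h1 : AnalyticAt ℝ (fun y => y - r y) x := analyticAt_id.sub hr
    exact ((p.analyticAt _).comp (hr.sub analyticAt_const)).add
      (h1.sub ((p.analyticAt _).comp h1))
  have hDf : HasFDerivAt f ((ContinuousLinearEquiv.refl ℝ X : X ≃L[ℝ] X) : X →L[ℝ] X) x := by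
    have h1 : HasFDerivAt (fun y => y - r y) (ContinuousLinearMap.id ℝ X - p) x :=
      (hasFDerivAt_id x).sub hDr
    have h2 := (p.hasFDerivAt.comp x (hDr.sub_const x)).add (h1.sub (p.hasFDerivAt.comp x h1))
    refine h2.congr_fderiv ?_
    ext v
    simp [hppa]
  obtain ⟨φ, hφ, hxφ, hφa, hφs⟩ := exists_analytic_openPartialHomeomorph hf _ hDf
  have hnhds : ∀ᶠ y in 𝓝 x, (r y ∈ S ∧ r (r y) = r y ∧ (y ∈ S → r y = y)) ∧ r y ∈ φ.source := by
    filter_upwards [hrS, hfix, hrc.eventually hfix,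
      hrc.eventually (φ.open_source.mem_nhds hxφ)] with y h1 h2 h3 h4
    exact ⟨⟨h1, h3 h1, h2⟩, h4⟩
  obtain ⟨U, hU, hUo, hxU⟩ := eventually_nhds_iff.1 hnhds
  refine ⟨φ.restrOpen U hUo, p.range, ⟨hxφ, hxU⟩, fun y hy => hφa y hy.1,
    fun y hy => hφs y hy.1, ?_, ?_⟩
  · exact ⟨p.codRestrict p.range fun y => ⟨y, rfl⟩, by
      rintro ⟨_, z, rfl⟩
      exact Subtype.ext (hppa z)⟩
  · ext y
    constructor
    · rintro ⟨z, ⟨hz, hzS⟩, rfl⟩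
      refine ⟨(φ.restrOpen U hUo).map_source hz, ?_⟩
      have hrz : r z = z := (hU z hz.2).1.2.2 hzS
      refine ⟨z - x, ?_⟩
      change _ = φ z
      simp [hφ, f, hrz]
    · rintro ⟨hy, hyW⟩
      obtain ⟨z, hz, rfl⟩ : ∃ z ∈ (φ.restrOpen U hUo).source, (φ.restrOpen U hUo) z = y :=
        ⟨_, (φ.restrOpen U hUo).map_target hy, (φ.restrOpen U hUo).right_inv hy⟩
      refine ⟨z, ⟨hz, ?_⟩, rfl⟩
      obtain ⟨⟨h1, h2, -⟩, h4⟩ := hU z hz.2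
      -- On the range of `p` the component `(1 - p) (z - r z)` vanishes, so `z` and `r z` have the
      -- same image; injectivity makes `z` a fixed point.
      have hpy : p (φ z) = φ z := by
        obtain ⟨v, hv⟩ := hyW
        have hv' : p v = φ z := hv
        rw [← hv', hppa]
      have key : φ (r z) = φ z := by
        rw [← hpy]
        simp [hφ, f, h2, hppa]
      rw [← φ.injOn h4 hz.1 key]
      exact h1

/-- An analytic map between submanifolds is a submersion as soon as it has an analytic local
section through each point of the source: in charts, the derivative of the section is a continuous
right inverse of the derivative of the map. -/
theorem isAnalyticSubmersion_of_local_section {F : X → Y} {S : Set X} {T : Set Y}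
    (hS : IsAnalyticSubmanifold S) (hT : IsAnalyticSubmanifold T) (hF : ∀ x, AnalyticAt ℝ F x)
    (hmaps : Set.MapsTo F S T)
    (hsec : ∀ x ∈ S, ∃ σ : Y → X, AnalyticAt ℝ σ (F x) ∧ σ (F x) = x ∧
      ∀ᶠ y in 𝓝 (F x), y ∈ T → σ y ∈ S ∧ F (σ y) = y) :
    IsAnalyticSubmersion F S T := by
  refine ⟨hS, hT, hmaps, fun x _ => (hF x).continuousAt.continuousWithinAt, ?_⟩
  intro x hxS φ W ψ V w₀ hφ hxφ hw₀ hψ hxψ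
  obtain ⟨σ, hσ, hσx, hσT⟩ := hsec x hxS
  obtain ⟨q, hq⟩ := hφ.complemented
  obtain ⟨p, hp⟩ := hψ.complemented
  have hback : φ.symm (w₀ : X) = x := by rw [hw₀, φ.left_inv hxφ]
  have hw₀t : (w₀ : X) ∈ φ.target := hw₀ ▸ φ.map_source hxφ
  -- Charts carry points of the submanifold to the model subspace, and back.
  have hφS {y : X} (hy : y ∈ φ.source) (hyS : y ∈ S) : φ y ∈ W :=
    (hφ.image_eq ▸ Set.mem_image_of_mem φ ⟨hy, hyS⟩ : φ y ∈ φ.target ∩ (W : Set X)).2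
  have hψT {y : Y} (hy : y ∈ ψ.source) (hyT : y ∈ T) : ψ y ∈ V :=
    (hψ.image_eq ▸ Set.mem_image_of_mem ψ ⟨hy, hyT⟩ : ψ y ∈ ψ.target ∩ (V : Set Y)).2
  have hφW {w : X} (hw : w ∈ φ.target) (hwW : w ∈ W) : φ.symm w ∈ S := by
    obtain ⟨z, ⟨hz, hzS⟩, rfl⟩ : w ∈ φ '' (φ.source ∩ S) := hφ.image_eq ▸ ⟨hw, hwW⟩
    rwa [φ.left_inv hz]
  have hψV {v : Y} (hv : v ∈ ψ.target) (hvV : v ∈ V) : ψ.symm v ∈ T := by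
    obtain ⟨z, ⟨hz, hzT⟩, rfl⟩ : v ∈ ψ '' (ψ.source ∩ T) := hψ.image_eq ▸ ⟨hv, hvV⟩
    rwa [ψ.left_inv hz]
  let v₀ : V := ⟨ψ (F x), hψT hxψ (hmaps hxS)⟩
  have hv₀t : (v₀ : Y) ∈ ψ.target := ψ.map_source hxψ
  have hv₀back : ψ.symm (v₀ : Y) = F x := ψ.left_inv hxψ
  set k : W → Y := fun w => ψ (F (φ.symm (w : X)))
  let l : V → W := fun v => q (φ (σ (ψ.symm (v : Y))))
  have hl₀ : l v₀ = w₀ := by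
    have : l v₀ = q (w₀ : X) := by simp only [l, hv₀back, hσx, hw₀]
    rw [this, hq]
  have hkan : AnalyticAt ℝ k w₀ := by
    have h1 : AnalyticAt ℝ (fun w : W => φ.symm (w : X)) w₀ :=
      (hφ.analytic_symm _ hw₀t).comp (W.subtypeL.analyticAt w₀)
    have h2 : AnalyticAt ℝ (fun w : W => F (φ.symm (w : X))) w₀ := (hF _).comp h1
    exact AnalyticAt.comp (g := ψ) (by rw [hback]; exact hψ.analytic _ hxψ) h2
  have hlan : AnalyticAt ℝ l v₀ := by
    have h1 : AnalyticAt ℝ (fun v : V => ψ.symm (v : Y)) v₀ :=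
      (hψ.analytic_symm _ hv₀t).comp (V.subtypeL.analyticAt v₀)
    have h2 : AnalyticAt ℝ (fun v : V => σ (ψ.symm (v : Y))) v₀ :=
      AnalyticAt.comp (g := σ) (by rwa [hv₀back]) h1
    have h3 : AnalyticAt ℝ (fun v : V => φ (σ (ψ.symm (v : Y)))) v₀ :=
      AnalyticAt.comp (g := φ) (by rw [hv₀back, hσx]; exact hφ.analytic _ hxφ) h2
    exact (q.analyticAt _).comp h3
  refine ⟨hkan, fderiv ℝ k w₀, hkan.differentiableAt.hasFDerivAt, ?_⟩
  set D := fderiv ℝ k w₀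
  set L := fderiv ℝ l v₀
  have hD : HasFDerivAt k D w₀ := hkan.differentiableAt.hasFDerivAt
  have hL : HasFDerivAt l L v₀ := hlan.differentiableAt.hasFDerivAt
  have hDV : (V.subtypeL.comp p).comp D = D := by
    have h1 : HasFDerivAt (fun w => (V.subtypeL.comp p) (k w)) ((V.subtypeL.comp p).comp D) w₀ :=
      (V.subtypeL.comp p).hasFDerivAt.comp w₀ hD
    refine (h1.congr_of_eventuallyEq ?_).unique hD
    have hc : ContinuousAt (fun w : W => F (φ.symm (w : X))) w₀ :=
      (hF _).continuousAt.comp ((hφ.analytic_symm _ hw₀t).continuousAt.comp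
        W.subtypeL.continuous.continuousAt)
    filter_upwards [continuous_subtype_val.continuousAt.eventually
      (φ.open_target.mem_nhds hw₀t), hc.eventually
      (ψ.open_source.mem_nhds (by simpa only [hback] using hxψ))] with w hw hw'
    have hV : k w ∈ V := hψT hw' (hmaps (hφW hw w.2))
    exact (congrArg Subtype.val (hp ⟨k w, hV⟩)).symm
  have hDL : D.comp L = V.subtypeL := by
    have h1 : HasFDerivAt (k ∘ l) (D.comp L) v₀ := HasFDerivAt.comp v₀ (by rwa [hl₀]) hL
    refine (h1.congr_of_eventuallyEq ?_).unique V.subtypeL.hasFDerivAt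
    have hc : Tendsto (fun v : V => ψ.symm (v : Y)) (𝓝 v₀) (𝓝 (F x)) := by
      have : ContinuousAt (fun v : V => ψ.symm (v : Y)) v₀ :=
        (hψ.analytic_symm _ hv₀t).continuousAt.comp V.subtypeL.continuous.continuousAt
      simpa [ContinuousAt, hv₀back] using this
    have hσc : Tendsto σ (𝓝 (F x)) (𝓝 x) := by simpa [ContinuousAt, hσx] using hσ.continuousAt
    filter_upwards [continuous_subtype_val.continuousAt.eventually
      (ψ.open_target.mem_nhds hv₀t), hc.eventually hσT,
      (hσc.comp hc).eventually (φ.open_source.mem_nhds hxφ)] with v hv hv' hv''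
    obtain ⟨hS', hFσ⟩ := hv' (hψV hv v.2)
    have hW := hφS hv'' hS'
    have hlv : (l v : X) = φ (σ (ψ.symm (v : Y))) := congrArg Subtype.val (hq ⟨_, hW⟩)
    change (v : Y) = ψ (F (φ.symm (l v : X)))
    have hv3 : σ (ψ.symm (v : Y)) ∈ φ.source := hv''
    rw [hlv, φ.left_inv hv3, hFσ, ψ.right_inv hv]
  have hDVa (w : W) : ((p (D w) : V) : Y) = D w := DFunLike.congr_fun hDV w
  have hDLa (v : V) : D (L v) = v := DFunLike.congr_fun hDL v
  constructor
  · apply le_antisymm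
    · rintro _ ⟨w, rfl⟩
      change D w ∈ V
      rw [← hDVa w]
      exact (p (D w)).2
    · intro v hv
      exact ⟨L ⟨v, hv⟩, hDLa ⟨v, hv⟩⟩
  · -- `1 - L p D` projects onto the kernel of `D`.
    refine ⟨(ContinuousLinearMap.id ℝ W - L.comp (p.comp D)).codRestrict D.ker fun w => ?_, ?_⟩
    · change D (w - L (p (D w))) = 0
      rw [map_sub, hDLa, hDVa, sub_self]
    · rintro ⟨w, hw⟩
      have hw' : D w = 0 := hw
      apply Subtype.ext
      simp [hw']

end Submanifolds

/-! ### Square roots near the identity -/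

section BanachAlgebra

variable {A : Type*} [NormedRing A] [NormedAlgebra ℝ A] [CompleteSpace A]

/-- Near `1` there is an analytic square root, obtained by inverting `a ↦ a * a`. By local
uniqueness it commutes, near `1`, with every continuous map preserving `1` and squares; this covers
involutions and conjugations by symmetries. -/
lemma exists_analytic_sqrt_near_one :
    ∃ c : A → A, AnalyticAt ℝ c 1 ∧ c 1 = 1 ∧ (∀ᶠ b in 𝓝 (1 : A), c b * c b = b) ∧
      ∀ σ : A → A, Continuous σ → σ 1 = 1 → (∀ a, σ (a * a) = σ a * σ a) →
        ∀ᶠ b in 𝓝 (1 : A), σ (c b) = c (σ b) := by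
  have hf : AnalyticAt ℝ (fun a : A => a * a) 1 := analyticAt_id.mul analyticAt_id
  let e : A ≃L[ℝ] A := ContinuousLinearEquiv.smulLeft (Units.mk0 (2 : ℝ) two_ne_zero)
  have hD : HasFDerivAt (fun a : A => a * a) (e : A →L[ℝ] A) 1 := by
    refine ((hasFDerivAt_id (𝕜 := ℝ) (1 : A)).mul' (hasFDerivAt_id (1 : A))).congr_fderiv ?_
    ext v
    simp [e, two_smul, Units.smul_def]
  obtain ⟨φ, hφ, h1, -, hs⟩ := exists_analytic_openPartialHomeomorph hf e hD
  have hφa (a : A) : φ a = a * a := congrFun hφ a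
  have hφ1 : φ 1 = 1 := by rw [hφa, one_mul]
  have h1t : (1 : A) ∈ φ.target := by simpa only [hφ1] using φ.map_source h1
  have hc1 : φ.symm 1 = 1 := by simpa only [hφ1] using φ.left_inv h1
  have hc : Tendsto φ.symm (𝓝 1) (𝓝 1) := by
    simpa only [ContinuousAt, hc1] using (hs 1 h1t).continuousAt
  have hsq : ∀ᶠ b in 𝓝 (1 : A), φ.symm b * φ.symm b = b := by
    filter_upwards [φ.open_target.mem_nhds h1t] with b hb
    rw [← hφa, φ.right_inv hb]
  refine ⟨φ.symm, hs 1 h1t, hc1, hsq, fun σ hσ hσ1 hσm => ?_⟩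
  have hσc : Tendsto σ (𝓝 1) (𝓝 1) := by
    simpa only [ContinuousAt, hσ1] using hσ.continuousAt (x := 1)
  filter_upwards [hsq, hσc.eventually hsq,
    (hσc.comp hc).eventually (φ.open_source.mem_nhds h1),
    (hc.comp hσc).eventually (φ.open_source.mem_nhds h1)] with b hb hb' h2 h3
  refine φ.injOn h2 h3 ?_
  rw [hφa, hφa]
  simp only [Function.comp_apply]
  rw [← hσm, hb, hb']

/-! ### Idempotents in a Banach algebra with involution -/

variable (τ : A →L[ℝ] A)

/-- The idempotents `q` commuting with `τ q`. -/
def normalIdempotents : Set A := {q | q * q = q ∧ q * τ q = τ q * q}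

/-- The idempotents fixed by `τ`. -/
def selfadjointIdempotents : Set A := {e | e * e = e ∧ τ e = e}

variable {τ} (hmul : ∀ a b, τ (a * b) = τ b * τ a) (hinv : ∀ a, τ (τ a) = a)
include hmul hinv

omit [CompleteSpace A] in
lemma involution_one : τ 1 = 1 := by
  have h := hmul 1 (τ 1)
  rwa [one_mul, hinv, one_mul, eq_comm] at h

omit [CompleteSpace A] in
lemma involution_conj (u q : A) : τ (u * q * τ u) = u * τ q * τ u := by
  rw [hmul, hmul, hinv, mul_assoc]

/-- The unitary part `u = s (τ(s) s)^{-1/2}` of an analytic map `s` with `s x₀ = 1`. Wherever `s`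
intertwines `q` with `t` and `τ q` with `τ t`, the element `τ(s) s` commutes with `q`, so `u` still
intertwines `q` with `t`. -/
lemma exists_analytic_unitary_part {s : A → A} {x₀ : A} (hs : AnalyticAt ℝ s x₀) (hs1 : s x₀ = 1) :
    ∃ u : A → A, AnalyticAt ℝ u x₀ ∧ u x₀ = 1 ∧
      (∀ᶠ x in 𝓝 x₀, τ (u x) * u x = 1) ∧
      ∀ q, q * q = q → ∀ᶠ x in 𝓝 x₀, ∀ t, s x * q = t * s x → s x * τ q = τ t * s x →
        u x * q * τ (u x) = t := by
  obtain ⟨c, hc, hc1, hsq, hcomm⟩ := exists_analytic_sqrt_near_one (A := A)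
  have hτ1 := involution_one hmul hinv
  let b : A → A := fun x => τ (s x) * s x
  have hb : AnalyticAt ℝ b x₀ := ((τ.analyticAt _).comp hs).mul hs
  have hb1 : b x₀ = 1 := by simp [b, hs1, hτ1]
  have hbt : Tendsto b (𝓝 x₀) (𝓝 1) := by simpa only [ContinuousAt, hb1] using hb.continuousAt
  have hcb : AnalyticAt ℝ (fun x => c (b x)) x₀ := AnalyticAt.comp (g := c) (by rwa [hb1]) hb
  have hcb1 : c (b x₀) = 1 := by rw [hb1, hc1]
  have hu : AnalyticAt ℝ (fun x => s x * Ring.inverse (c (b x))) x₀ :=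
    hs.mul (AnalyticAt.comp (g := Ring.inverse)
      (by simpa only [hcb1, Units.val_one] using analyticAt_inverse (𝕜 := ℝ) (1 : Aˣ)) hcb)
  have hsunit : ∀ᶠ x in 𝓝 x₀, IsUnit (s x) :=
    hs.continuousAt.eventually (Units.isOpen.mem_nhds (by simp [hs1]))
  have hcunit : ∀ᶠ x in 𝓝 x₀, IsUnit (c (b x)) :=
    hcb.continuousAt.eventually (Units.isOpen.mem_nhds (by simp [hcb1]))
  have hτc : ∀ᶠ x in 𝓝 x₀, τ (c (b x)) = c (τ (b x)) :=
    hbt.eventually (hcomm τ τ.continuous hτ1 fun a => hmul a a)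
  have hunit : ∀ᶠ x in 𝓝 x₀,
      τ (s x * Ring.inverse (c (b x))) * (s x * Ring.inverse (c (b x))) = 1 := by
    filter_upwards [hcunit, hτc, hbt.eventually hsq] with x h2 h3 h4
    have hτb : τ (b x) = b x := by simp only [b, hmul, hinv]
    rw [hτb] at h3
    set w := c (b x)
    have hwi : w * Ring.inverse w = 1 := Ring.mul_inverse_cancel _ h2
    have hiw : Ring.inverse w * w = 1 := Ring.inverse_mul_cancel _ h2
    have hτi : τ (Ring.inverse w) = Ring.inverse w := by
      have h5 : τ (Ring.inverse w) * w = 1 := by rw [← h3, ← hmul, h3, hwi, hτ1]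
      calc τ (Ring.inverse w) = τ (Ring.inverse w) * w * Ring.inverse w := by
            rw [mul_assoc, hwi, mul_one]
        _ = Ring.inverse w := by rw [h5, one_mul]
    calc τ (s x * Ring.inverse w) * (s x * Ring.inverse w)
        = Ring.inverse w * (b x) * Ring.inverse w := by rw [hmul, hτi]; simp only [b, mul_assoc]
      _ = (Ring.inverse w * w) * (w * Ring.inverse w) := by rw [← h4]; simp only [mul_assoc]
      _ = 1 := by rw [hwi, hiw, one_mul]
  refine ⟨_, hu, by simp [hs1, hcb1], hunit, fun q hq => ?_⟩
  -- `b x` and `q` commute, hence so do `b x` and the symmetry `2q - 1`; conjugation by the latter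
  -- fixes `b x`, so it fixes `c (b x)`, which therefore commutes with `q`.
  have hv : (q + q - 1) * (q + q - 1) = 1 := by
    simp only [mul_add, add_mul, mul_sub, sub_mul, mul_one, one_mul, hq]
    abel
  have hconj := hcomm (fun a => (q + q - 1) * a * (q + q - 1)) (by fun_prop) (by simpa using hv)
    (fun a => by
      calc (q + q - 1) * (a * a) * (q + q - 1)
          = (q + q - 1) * a * 1 * (a * (q + q - 1)) := by simp only [mul_one, mul_assoc]
        _ = (q + q - 1) * a * ((q + q - 1) * (q + q - 1)) * (a * (q + q - 1)) := by rw [hv]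
        _ = _ := by simp only [mul_assoc])
  filter_upwards [hunit, hsunit, hcunit, hbt.eventually hconj] with x h1 h2 h3 h4 t ht ht'
  have hbq : b x * q = q * b x := by
    have h5 : τ (s x) * t = q * τ (s x) := by
      have := congrArg τ ht'
      rwa [hmul, hmul, hinv, hinv, eq_comm] at this
    calc b x * q = τ (s x) * (s x * q) := by simp only [b, mul_assoc]
      _ = τ (s x) * t * s x := by rw [ht, mul_assoc]
      _ = q * b x := by rw [h5]; simp only [b, mul_assoc]
  have hvb : (q + q - 1) * b x * (q + q - 1) = b x := by
    have : (q + q - 1) * b x = b x * (q + q - 1) := by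
      simp only [mul_add, add_mul, mul_sub, sub_mul, mul_one, one_mul, hbq]
    rw [this, mul_assoc, hv, mul_one]
  rw [hvb] at h4
  set w := c (b x)
  have hwi : w * Ring.inverse w = 1 := Ring.mul_inverse_cancel _ h3
  have hiw : Ring.inverse w * w = 1 := Ring.inverse_mul_cancel _ h3
  have hqw : q * w = w * q := by
    have h5 : (q + q - 1) * w = w * (q + q - 1) := by
      calc (q + q - 1) * w = (q + q - 1) * w * ((q + q - 1) * (q + q - 1)) := by rw [hv, mul_one]
        _ = w * (q + q - 1) := by rw [← mul_assoc, h4]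
    have h6 : q * w + q * w = w * q + w * q := by
      simpa only [mul_add, add_mul, mul_sub, sub_mul, mul_one, one_mul, sub_left_inj] using h5
    rw [← two_smul ℝ, ← two_smul ℝ] at h6
    exact smul_right_injective A (two_ne_zero (α := ℝ)) h6
  have hiq : Ring.inverse w * q = q * Ring.inverse w := by
    calc Ring.inverse w * q = Ring.inverse w * (q * w) * Ring.inverse w := by
          rw [mul_assoc, mul_assoc, hwi, mul_one]
      _ = Ring.inverse w * w * (q * Ring.inverse w) := by rw [hqw]; simp only [mul_assoc]
      _ = q * Ring.inverse w := by rw [hiw, one_mul]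
  have huu : s x * Ring.inverse w * τ (s x * Ring.inverse w) = 1 := by
    have hU : IsUnit (s x * Ring.inverse w) := h2.mul h3.ringInverse
    obtain ⟨U, hU⟩ := hU
    rw [← hU] at h1 ⊢
    rw [Units.eq_inv_of_mul_eq_one_right h1, Units.mul_inv]
  calc s x * Ring.inverse w * q * τ (s x * Ring.inverse w)
      = s x * q * Ring.inverse w * τ (s x * Ring.inverse w) := by
        rw [mul_assoc (s x), hiq, ← mul_assoc (s x)]
    _ = t * (s x * Ring.inverse w * τ (s x * Ring.inverse w)) := by rw [ht]; simp only [mul_assoc]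
    _ = t := by rw [huu, mul_one]

/-- Unitaries implementing the selfadjoint idempotents near a given one `e`, from the intertwiner
`s y = y e + (1 - y) (1 - e)`. -/
lemma exists_unitary_transport_selfadjoint {e : A} (he : e ∈ selfadjointIdempotents τ) :
    ∃ u : A → A, AnalyticAt ℝ u e ∧ u e = 1 ∧ (∀ᶠ y in 𝓝 e, τ (u y) * u y = 1) ∧
      ∀ᶠ y in 𝓝 e, y ∈ selfadjointIdempotents τ → u y * e * τ (u y) = y := by
  obtain ⟨h1, h2⟩ := he
  have hs : AnalyticAt ℝ (fun y : A => y * e + (1 - y) * (1 - e)) e :=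
    (analyticAt_id.mul analyticAt_const).add
      ((analyticAt_const.sub analyticAt_id).mul analyticAt_const)
  obtain ⟨u, hu, hu1, huu, ht⟩ := exists_analytic_unitary_part hmul hinv hs (by
    simp only [mul_sub, sub_mul, mul_one, one_mul, h1]
    abel)
  refine ⟨u, hu, hu1, huu, ?_⟩
  filter_upwards [ht e h1] with y hy ⟨hyy, hτy⟩
  have key : (y * e + (1 - y) * (1 - e)) * e = y * (y * e + (1 - y) * (1 - e)) := by
    have hy2 (a : A) : y * (y * a) = y * a := by rw [← mul_assoc, hyy]
    simp only [mul_add, add_mul, mul_sub, sub_mul, mul_one, one_mul, mul_assoc, h1, hyy, hy2]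
    abel
  exact hy y key (by rwa [h2, hτy])

/-- Unitaries implementing the normal idempotents near a given one `q`. The intertwiner
`s y = ∑ yᵢ (τ y)ⱼ qᵢ (τ q)ⱼ`, with `a₁ = a` and `a₀ = 1 - a`, matches the four joint spectral
idempotents of `q` and `τ q` with those of `y` and `τ y`. -/
lemma exists_unitary_transport_normal {q : A} (hq : q ∈ normalIdempotents τ) :
    ∃ u : A → A, AnalyticAt ℝ u q ∧ u q = 1 ∧ (∀ᶠ y in 𝓝 q, τ (u y) * u y = 1) ∧
      ∀ᶠ y in 𝓝 q, y ∈ normalIdempotents τ → u y * q * τ (u y) = y := by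
  obtain ⟨h1, h2⟩ := hq
  have hτ {a : A} (h : a * a = a) : τ a * τ a = τ a := by rw [← hmul, h]
  have h2' := h2.symm
  have h3 := hτ h1
  have hT : AnalyticAt ℝ (fun y : A => τ y) q := τ.analyticAt q
  have hI : AnalyticAt ℝ (fun y : A => y) q := analyticAt_id
  have hs : AnalyticAt ℝ (fun y : A => y * τ y * (q * τ q) + y * (1 - τ y) * (q * (1 - τ q))
      + (1 - y) * τ y * ((1 - q) * τ q) + (1 - y) * (1 - τ y) * ((1 - q) * (1 - τ q))) q :=
    ((((hI.mul hT).mul analyticAt_const).add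
      ((hI.mul (analyticAt_const.sub hT)).mul analyticAt_const)).add
      (((analyticAt_const.sub hI).mul hT).mul analyticAt_const)).add
      (((analyticAt_const.sub hI).mul (analyticAt_const.sub hT)).mul analyticAt_const)
  have r1 {p : A} (h : p * p = p) (a : A) : p * (p * a) = p * a := by rw [← mul_assoc, h]
  have r2 {p p' : A} (h : p' * p = p * p') (a : A) : p' * (p * a) = p * (p' * a) := by
    rw [← mul_assoc, h, mul_assoc]
  obtain ⟨u, hu, hu1, huu, ht⟩ := exists_analytic_unitary_part hmul hinv hs (by
    simp only [mul_sub, sub_mul, mul_one, one_mul, mul_assoc, h1, h2', h3,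
      r1 h1, r2 h2']
    abel)
  refine ⟨u, hu, hu1, huu, ?_⟩
  filter_upwards [ht q h1] with y hy ⟨hyy, hyτ⟩
  have hyτ' := hyτ.symm
  have hy3 := hτ hyy
  refine hy y ?_ ?_ <;>
  · simp only [mul_add, add_mul, mul_sub, sub_mul, mul_one, one_mul, mul_assoc, h1, h2', h3,
      r1 h1, hyy, hyτ', hy3, r1 hyy, r1 hy3, r2 hyτ']
    abel

omit hmul hinv [CompleteSpace A] in
lemma conj_mul_conj {u : A} (hu : τ u * u = 1) (a b : A) :
    u * a * τ u * (u * b * τ u) = u * (a * b) * τ u := by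
  calc u * a * τ u * (u * b * τ u) = u * a * (τ u * u) * b * τ u := by simp only [mul_assoc]
    _ = _ := by rw [hu, mul_one]; simp only [mul_assoc]

omit [CompleteSpace A] in
lemma conj_mem_normalIdempotents {u q : A} (hu : τ u * u = 1) (hq : q ∈ normalIdempotents τ) :
    u * q * τ u ∈ normalIdempotents τ := by
  refine ⟨by rw [conj_mul_conj hu, hq.1], ?_⟩
  rw [involution_conj hmul hinv, conj_mul_conj hu, conj_mul_conj hu, hq.2]

omit [CompleteSpace A] in
lemma conj_mem_selfadjointIdempotents {u e : A} (hu : τ u * u = 1)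
    (he : e ∈ selfadjointIdempotents τ) : u * e * τ u ∈ selfadjointIdempotents τ :=
  ⟨by rw [conj_mul_conj hu, he.1], by rw [involution_conj hmul hinv, he.2]⟩

omit [CompleteSpace A] in
lemma mul_involution_mem_selfadjointIdempotents {q : A} (hq : q ∈ normalIdempotents τ) :
    q * τ q ∈ selfadjointIdempotents τ := by
  refine ⟨?_, by rw [hmul, hinv]⟩
  calc q * τ q * (q * τ q) = q * (τ q * q) * τ q := by simp only [mul_assoc]
    _ = (q * q) * (τ q * τ q) := by rw [← hq.2]; simp only [mul_assoc]
    _ = q * τ q := by rw [← hmul, hq.1]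

omit hmul hinv [CompleteSpace A] in
lemma analyticAt_conj {u : A → A} {x : A} (hu : AnalyticAt ℝ u x) (q : A) :
    AnalyticAt ℝ (fun y => u y * q * τ (u y)) x :=
  (hu.mul analyticAt_const).mul ((τ.analyticAt _).comp hu)

theorem isAnalyticSubmanifold_normalIdempotents :
    IsAnalyticSubmanifold (normalIdempotents τ) := by
  refine isAnalyticSubmanifold_of_local_retraction fun q hq => ?_
  obtain ⟨u, hu, -, huu, ht⟩ := exists_unitary_transport_normal hmul hinv hq
  exact ⟨fun y => u y * q * τ (u y), analyticAt_conj hu q,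
    huu.mono fun y hy => conj_mem_normalIdempotents hmul hinv hy hq, ht⟩

theorem isAnalyticSubmanifold_selfadjointIdempotents :
    IsAnalyticSubmanifold (selfadjointIdempotents τ) := by
  refine isAnalyticSubmanifold_of_local_retraction fun e he => ?_
  obtain ⟨u, hu, -, huu, ht⟩ := exists_unitary_transport_selfadjoint hmul hinv he
  exact ⟨fun y => u y * e * τ (u y), analyticAt_conj hu e,
    huu.mono fun y hy => conj_mem_selfadjointIdempotents hmul hinv hy he, ht⟩

/-- The local section through `q` moves `q` by the unitaries that implement the selfadjoint
idempotents near `q * τ q`. -/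
theorem isAnalyticSubmersion_mul_involution :
    IsAnalyticSubmersion (fun q : A => q * τ q) (normalIdempotents τ)
      (selfadjointIdempotents τ) := by
  refine isAnalyticSubmersion_of_local_section
    (isAnalyticSubmanifold_normalIdempotents hmul hinv)
    (isAnalyticSubmanifold_selfadjointIdempotents hmul hinv)
    (fun x => analyticAt_id.mul (τ.analyticAt x))
    (fun q hq => mul_involution_mem_selfadjointIdempotents hmul hinv hq) fun q hq => ?_
  obtain ⟨u, hu, hu1, huu, ht⟩ := exists_unitary_transport_selfadjoint hmul hinv
    (mul_involution_mem_selfadjointIdempotents hmul hinv hq)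
  refine ⟨fun y => u y * q * τ (u y), analyticAt_conj hu q,
    by simp [hu1, involution_one hmul hinv], ?_⟩
  filter_upwards [huu, ht] with y hy hy' hyE
  refine ⟨conj_mem_normalIdempotents hmul hinv hy hq, ?_⟩
  rw [involution_conj hmul hinv, conj_mul_conj hy]
  exact hy' hyE

omit [CompleteSpace A] in
lemma image_mul_involution :
    (fun q : A => q * τ q) '' normalIdempotents τ = selfadjointIdempotents τ := by
  refine Set.Subset.antisymm ?_ fun e he => ?_
  · rintro _ ⟨q, hq, rfl⟩
    exact mul_involution_mem_selfadjointIdempotents hmul hinv hq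
  · refine ⟨e, ⟨he.1, by rw [he.2]⟩, ?_⟩
    change e * τ e = e
    rw [he.2, he.1]

end BanachAlgebra

/-! ### Projections in a Krein space -/

theorem mainTheorem2 {H : Type*} [NormedAddCommGroup H] [InnerProductSpace ℂ H] [CompleteSpace H]
    (J : H →L[ℂ] H) (hJ_selfadjoint : ContinuousLinearMap.adjoint J = J) (hJ_inv : J * J = 1) :
    IsAnalyticSubmanifold (jNormalProjections J) ∧
    IsAnalyticSubmanifold (jSelfadjointProjections J) ∧
    IsAnalyticSubmersion (fun Q : H →L[ℂ] H => Q * jAdjoint J Q)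
      (jNormalProjections J) (jSelfadjointProjections J) ∧
    (fun Q : H →L[ℂ] H => Q * jAdjoint J Q) '' jNormalProjections J =
      jSelfadjointProjections J := by
  -- The real algebra structure whose scalar multiplication is the one of the real Banach space.
  let _ : NormedAlgebra ℝ (H →L[ℂ] H) :=
    { Algebra.ofModule (fun r a b => by ext x; simp) (fun r a b => by ext x; simp) with
      norm_smul_le := fun r a => (norm_smul r a).le }
  let τ : (H →L[ℂ] H) →L[ℝ] (H →L[ℂ] H) := LinearMap.mkContinuous
    { toFun := jAdjoint J
      map_add' := fun a b => by simp only [jAdjoint, map_add, mul_add, add_mul]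
      map_smul' := fun r a => by
        have hr : r • a = (r : ℂ) • a := by ext x; simp
        rw [jAdjoint, hr, map_smulₛₗ]
        ext x
        simp [jAdjoint] } (‖J‖ * ‖J‖) fun a => by
      calc ‖J * ContinuousLinearMap.adjoint a * J‖
          ≤ ‖J‖ * ‖ContinuousLinearMap.adjoint a‖ * ‖J‖ :=
            (norm_mul_le _ _).trans (by gcongr; exact norm_mul_le _ _)
        _ = ‖J‖ * ‖J‖ * ‖a‖ := by rw [LinearIsometryEquiv.norm_map]; ring
  have hmul (a b : H →L[ℂ] H) : τ (a * b) = τ b * τ a := by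
    have hadj : ContinuousLinearMap.adjoint (a * b) =
        ContinuousLinearMap.adjoint b * ContinuousLinearMap.adjoint a :=
      ContinuousLinearMap.adjoint_comp a b
    calc J * ContinuousLinearMap.adjoint (a * b) * J
        = J * ContinuousLinearMap.adjoint b * 1 * ContinuousLinearMap.adjoint a * J := by
          rw [hadj]; simp only [mul_assoc, one_mul]
      _ = jAdjoint J b * jAdjoint J a := by rw [← hJ_inv]; simp only [jAdjoint, mul_assoc]
  have hinv (a : H →L[ℂ] H) : τ (τ a) = a := by
    have hadj : ContinuousLinearMap.adjoint (J * ContinuousLinearMap.adjoint a * J) = J * a * J := by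
      change star (J * star a * J) = J * a * J
      have hJ : star J = J := hJ_selfadjoint
      simp only [star_mul, star_star, hJ, mul_assoc]
    calc J * ContinuousLinearMap.adjoint (J * ContinuousLinearMap.adjoint a * J) * J
        = (J * J) * a * (J * J) := by rw [hadj]; simp only [mul_assoc]
      _ = a := by rw [hJ_inv, one_mul, mul_one]
  exact ⟨isAnalyticSubmanifold_normalIdempotents hmul hinv,
    isAnalyticSubmanifold_selfadjointIdempotents hmul hinv,
    isAnalyticSubmersion_mul_involution hmul hinv, image_mul_involution hmul hinv⟩
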